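/- Let $D\subset\mathbb C^n$, $n>1$, be a domain with $C^2$-smooth boundary, let $\xi\in\partial D$, and let $\nu$ be the unit outward normal to $\partial D$ at $\xi$. Write $z-\xi=z_1(-\nu)+z'$ with $z_1=x_1+iy_1\in\mathbb C$ and $z'$ Hermitian-orthogonal to $\nu$, and put $\zeta=z-\xi-x_1(-\nu)$, the component of $z-\xi$ in the real tangent hyperplane. Near $\xi$ the domain is given by $x_1>\psi(\zeta)$, where $\psi$ is a $C^2$ function with $\psi(0)=0$ and $\nabla\psi(0)=0$. Set $d(z)=\min\{x_1,\,x_1-\psi(\zeta)\}$ and, for $\alpha>0$, $$A_\alpha(\xi)=\{z\in D:\ |z-\xi|^2<\alpha\, d(z),\ |y_1|<\alpha x_1\}$$ (only the part of $A_\alpha(\xi)$ near $\xi$ matters). Let $f$ be a function such that for every $\alpha>0$ it is holomorphic in the part of $A_\alpha(\xi)$ lying in some neighbourhood of $\xi$ (which may depend on $\alpha$). Suppose that for every $\alpha>0$ there is a constant $K=K(\alpha)$ such that for all $z\in A_\alpha(\xi)$ sufficiently close to $\xi$ the spherical derivatives of $f$ in the complex normal and complex tangential directions satisfy $$\frac{|df_z(\nu_{\zeta(z)})|}{1+|f(z)|^2}\le\frac{K}{d(z)},\qquad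 \frac{|df_z(\tau)|}{1+|f(z)|^2}\le\frac{K}{\sqrt{d(z)}},$$ for every unit vector $\tau$ Hermitian-orthogonal to $\nu_{\zeta(z)}$, where $\zeta(z)$ is the point of $\partial D$ closest to $z$ and $\nu_{\zeta(z)}$ is the unit outward normal to $\partial D$ there. If, for some $\beta>0$ and some $L\in\mathbb C\cup\{\infty\}$, $f(z)\to L$ as $z\to\xi$ within $A_\beta(\xi)$, then $f$ has admissible limit $L$ at $\xi$: for every $\alpha>0$, $f(z)\to L$ as $z\to\xi$ within $A_\alpha(\xi)$, and also as $z\to\xi$ within $$\mathcal A_\alpha(\xi)=\{z\in D:\ x_1>0,\ |(z-\xi,\nu)|<(1+\alpha)\delta_\xi(z),\ |z-\xi|^2<\alpha\,\delta_\xi(z)\},$$ where $(\cdot,\cdot)$ is the Hermitian product and $\delta_\xi(z)$ is the minimum of the distances from $z$ to $\partial D$ and to the real tangent hyperplane of $\partial D$ at $\xi$. -/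

import Mathlib

noncomputable section

namespace AdmissibleLimit

open Filter Topology

/-- The space `ℂⁿ` with its Hermitian norm; `inner ℂ u v = ∑ j, conj (u j) * v j`. -/
abbrev Cn (n : ℕ) := EuclideanSpace ℂ (Fin n)

variable {n : ℕ}

/-- The complex coordinate `z₁ = x₁ + i y₁` of `z` along the inner normal `-ν` at `ξ`. -/
def normalCoord (ξ ν z : Cn n) : ℂ := inner ℂ (-ν) (z - ξ)

/-- The component `z - ξ - x₁ (-ν)` of `z - ξ` in the real hyperplane
`{v | Re ⟪ν, v⟫ = 0}` (for a unit vector `ν`). -/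
def tangentialPart (ξ ν z : Cn n) : Cn n := z - ξ + (normalCoord ξ ν z).re • ν

/-- Near `ξ` the set `D` is the strict epigraph `x₁ > ψ` of a `C²` function `ψ` on the real
hyperplane orthogonal to `ν`, with `-ν` pointing into `D` and with `ψ`, `∇ψ` vanishing at the
origin.  Only the values of `ψ` on that hyperplane matter; it is defined on all of `ℂⁿ` for
convenience (compose with the orthogonal projection). -/
structure IsC2GraphAt (D : Set (Cn n)) (ξ ν : Cn n) (ψ : Cn n → ℝ) : Prop where
  norm_normal : ‖ν‖ = 1
  contDiffAt : ContDiffAt ℝ 2 ψ 0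
  map_zero : ψ 0 = 0
  fderiv_zero : fderiv ℝ ψ 0 = 0
  mem_iff : ∀ᶠ z in 𝓝 ξ, (z ∈ D ↔ ψ (tangentialPart ξ ν z) < (normalCoord ξ ν z).re)

/-- `ν` is the unit outward normal to `∂D` at `ξ`. -/
def IsOuterUnitNormal (D : Set (Cn n)) (ξ ν : Cn n) : Prop :=
  ∃ ψ : Cn n → ℝ, IsC2GraphAt D ξ ν ψ

/-- `D` has `C²`-smooth boundary: near each boundary point it is the region on one side of a
`C²` graph over the tangent hyperplane. -/
def HasC2Boundary (D : Set (Cn n)) : Prop :=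
  ∀ ξ ∈ frontier D, ∃ ν : Cn n, IsOuterUnitNormal D ξ ν

/-- `d(z) = min {x₁, x₁ - ψ}`. -/
def graphDist (ξ ν : Cn n) (ψ : Cn n → ℝ) (z : Cn n) : ℝ :=
  min (normalCoord ξ ν z).re ((normalCoord ξ ν z).re - ψ (tangentialPart ξ ν z))

/-- The approach region `A_α(ξ) = {z ∈ D : |z - ξ|² < α d(z), |y₁| < α x₁}`. -/
def approachRegion (D : Set (Cn n)) (ξ ν : Cn n) (ψ : Cn n → ℝ) (α : ℝ) : Set (Cn n) :=
  {z | z ∈ D ∧ ‖z - ξ‖ ^ 2 < α * graphDist ξ ν ψ z ∧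
    |(normalCoord ξ ν z).im| < α * (normalCoord ξ ν z).re}

/-- The real tangent hyperplane at `ξ`, as an affine hyperplane through `ξ`. -/
def tangentPlane (ξ ν : Cn n) : Set (Cn n) := {w | (inner ℂ ν (w - ξ)).re = 0}

/-- `δ_ξ(z)`: the smaller of the distances from `z` to `∂D` and to the tangent hyperplane. -/
def stdDist (D : Set (Cn n)) (ξ ν z : Cn n) : ℝ :=
  min (Metric.infDist z (frontier D)) (Metric.infDist z (tangentPlane ξ ν))

/-- The admissible approach domain with vertex `ξ` and aperture `α`, consisting of points of `D`
on the inner side of the tangent hyperplane (`x₁ > 0`). -/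
def admissibleDomain (D : Set (Cn n)) (ξ ν : Cn n) (α : ℝ) : Set (Cn n) :=
  {z | z ∈ D ∧ 0 < (normalCoord ξ ν z).re ∧
    ‖inner ℂ ν (z - ξ)‖ < (1 + α) * stdDist D ξ ν z ∧
    ‖z - ξ‖ ^ 2 < α * stdDist D ξ ν z}

/-- `f(z) → L` in the Riemann sphere as `z → ξ` within `A`. -/
def HasLimitWithin (f : Cn n → ℂ) (A : Set (Cn n)) (ξ : Cn n) (L : OnePoint ℂ) : Prop :=
  Tendsto (fun z => (f z : OnePoint ℂ)) (𝓝[A] ξ) (𝓝 L)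

/-- The spherical derivative of `f` at `z` in the direction `v`. -/
def sphericalDeriv (f : Cn n → ℂ) (z v : Cn n) : ℝ :=
  ‖fderiv ℂ f z v‖ / (1 + ‖f z‖ ^ 2)

/-- `ζ` is a point of `∂D` closest to `z`. -/
def IsClosestBoundaryPoint (D : Set (Cn n)) (z ζ : Cn n) : Prop :=
  ζ ∈ frontier D ∧ dist z ζ = Metric.infDist z (frontier D)

/-- At `z`, the spherical derivative of `f` in the complex normal direction is at most `a`, and in
every unit complex tangential direction it is at most `b`; normal and tangential refer to the
point of `∂D` closest to `z`. -/
def SphericalDerivBounds (D : Set (Cn n)) (f : Cn n → ℂ) (z : Cn n) (a b : ℝ) : Prop :=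
  ∀ ζ ν : Cn n, IsClosestBoundaryPoint D z ζ → IsOuterUnitNormal D ζ ν →
    sphericalDeriv f z ν ≤ a ∧
    ∀ τ : Cn n, ‖τ‖ = 1 → inner ℂ ν τ = 0 → sphericalDeriv f z τ ≤ b

end AdmissibleLimit

end

noncomputable section

namespace AdmissibleLimit

open Filter Topology
open Metric (ball closedBall)

/-! Write `z = ξ - x₁ν + ζ` with `ζ` in the real tangent hyperplane, and join `z` to a smaller
approach region by the holomorphic disc `c ↦ ξ - x₁ν + cζ` (`tangentialDilation`). For `c` near `0`
its points lie in `A_β`, where the limit is known; `c = 1` gives `z`; for `c` near `[0, 1]` they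
stay in some `A_α'` with `d` at least half of `d(z)`. The second claim rests on `ψ(sζ) ≈ s²ψ(ζ)`: up
to a small multiple of `d(z)`, `x₁ - ψ(sζ)` lies between `x₁` and `x₁ - ψ(ζ)`, both at least `d(z)`.
This is why `d` is a minimum. A bound `|ψ| ≤ C|ζ|²` alone would not do, since the aperture is
arbitrary.

The disc has velocity `ζ`, of length `O(√d)`, whose complex normal component is `iy₁(-ν)`, of size
`O(d)`. The assumed bounds refer to the normal at the closest boundary point, but that normal is
within `O(√d)` of `ν`, which costs only a term of the tangential order
(`exists_norm_fderiv_le_of_sphericalDerivBounds`). Hence the functions `c ↦ f(ξ - x₁ν + cζ)` have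
spherical derivatives bounded uniformly in `z`. A limit of such a family, uniform near `c = 0`,
propagates to `c = 1` in finitely many steps (`tendsto_one_of_tendsto_ball_zero`): a Vitali-type
argument done by hand with Taylor coefficients. -/

/-! ### One complex variable: propagation of limits under spherical derivative bounds -/

/-- A bound on the spherical derivative of a holomorphic function makes `1 / (1 + ‖g‖²)`
Lipschitz. -/
theorem abs_inv_one_add_sq_sub_le {g : ℂ → ℂ} {s : Set ℂ} (hs : Convex ℝ s) {M : ℝ}
    (hd : ∀ w ∈ s, DifferentiableAt ℂ g w)
    (hM : ∀ w ∈ s, ‖deriv g w‖ ≤ M * (1 + ‖g w‖ ^ 2)) {w₁ w₂ : ℂ} (h₁ : w₁ ∈ s) (h₂ : w₂ ∈ s) :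
    |(1 + ‖g w₂‖ ^ 2)⁻¹ - (1 + ‖g w₁‖ ^ 2)⁻¹| ≤ M * ‖w₂ - w₁‖ := by
  have key : ∀ w ∈ s, ∃ φ : ℂ →L[ℝ] ℝ,
      HasFDerivAt (fun w => (1 + ‖g w‖ ^ 2)⁻¹) φ w ∧ ‖φ‖ ≤ M := by
    intro w hw
    have h1 : HasFDerivAt g ((fderiv ℂ g w).restrictScalars ℝ) w :=
      (hd w hw).hasFDerivAt.restrictScalars ℝ
    have h2 := (h1.norm_sq).const_add (1 : ℝ)
    have hpos : 0 < 1 + ‖g w‖ ^ 2 := by positivity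
    have h3 := (hasDerivAt_inv hpos.ne').comp_hasFDerivAt w h2
    refine ⟨_, h3, ?_⟩
    have hM0 : 0 ≤ M := by
      by_contra h
      have := (norm_nonneg _).trans (hM w hw)
      nlinarith
    refine ContinuousLinearMap.opNorm_le_bound _ hM0 fun v => ?_
    have h4 : ‖(fderiv ℂ g w) v‖ ≤ M * (1 + ‖g w‖ ^ 2) * ‖v‖ := by
      refine ((fderiv ℂ g w).le_opNorm v).trans ?_
      gcongr
      rw [← norm_deriv_eq_norm_fderiv]
      exact hM w hw
    have h5 : |inner ℝ (g w) ((fderiv ℂ g w) v)| ≤ ‖g w‖ * (M * (1 + ‖g w‖ ^ 2) * ‖v‖) :=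
      (abs_real_inner_le_norm _ _).trans (by gcongr)
    -- The derivative of `1 / (1 + |g|²)` is at most `2|g||g'| / (1 + |g|²)²`; this inequality
    -- cancels one factor and leaves the spherical derivative.
    have h6 : ‖g w‖ * 2 ≤ 1 + ‖g w‖ ^ 2 := by nlinarith [sq_nonneg (‖g w‖ - 1)]
    simp only [_root_.smul_apply, ContinuousLinearMap.comp_apply,
      ContinuousLinearMap.coe_restrictScalars', innerSL_apply_apply, smul_eq_mul, nsmul_eq_mul,
      norm_mul, norm_neg, norm_inv, norm_pow, Real.norm_eq_abs, abs_of_pos hpos, Nat.cast_ofNat,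
      Nat.abs_ofNat]
    rw [inv_mul_le_iff₀ (by positivity)]
    calc 2 * |inner ℝ (g w) ((fderiv ℂ g w) v)|
        ≤ 2 * (‖g w‖ * (M * (1 + ‖g w‖ ^ 2) * ‖v‖)) := by gcongr
      _ = (‖g w‖ * 2) * (M * (1 + ‖g w‖ ^ 2) * ‖v‖) := by ring
      _ ≤ (1 + ‖g w‖ ^ 2) * (M * (1 + ‖g w‖ ^ 2) * ‖v‖) := by gcongr
      _ = _ := by ring
  choose! φ hφ hφM using key
  exact hs.norm_image_sub_le_of_norm_hasFDerivWithin_le (𝕜 := ℝ)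
    (fun w hw => (hφ w hw).hasFDerivWithinAt) hφM h₁ h₂

variable {ι : Type*} {l : Filter ι}

/-- A uniformly bounded family of holomorphic functions on a disc which tends to `0` uniformly on
a concentric disc does so on every concentric disc of smaller radius. -/
theorem tendsto_zero_of_bounded {h : ι → ℂ → ℂ} {c : ℂ} {ρ ρ' ε C : ℝ} (hε : 0 < ε)
    (hρ' : 0 < ρ') (hρ : ρ' < ρ)
    (hd : ∀ᶠ i in l, ∀ w ∈ ball c ρ, DifferentiableAt ℂ (h i) w)
    (hb : ∀ᶠ i in l, ∀ w ∈ ball c ρ, ‖h i w‖ ≤ C)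
    (h0 : Tendsto (fun p : ι × ℂ => h p.1 p.2) (l ×ˢ 𝓟 (ball c ε)) (𝓝 0)) :
    Tendsto (fun p : ι × ℂ => h p.1 p.2) (l ×ˢ 𝓟 (ball c ρ')) (𝓝 0) := by
  obtain ⟨r, hr', hr⟩ := exists_between hρ
  have hr0 : 0 < r := hρ'.trans hr'
  have sph : ∀ {t : ℝ}, t < ρ → Metric.sphere c t ⊆ ball c ρ := fun ht w hw => by
    rw [Metric.mem_sphere] at hw; rw [Metric.mem_ball]; linarith
  have dcl : ∀ {t : ℝ}, 0 < t → t < ρ → ∀ i, (∀ w ∈ ball c ρ, DifferentiableAt ℂ (h i) w) →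
      DiffContOnCl ℂ (h i) (ball c t) := fun ht0 ht i hi =>
    (DifferentiableOn.diffContOnCl_ball (U := ball c ρ)
      (fun w hw => (hi w hw).differentiableWithinAt) (Metric.closedBall_subset_ball ht))
  -- These terms majorize the Taylor series on the disc of radius `ρ'`. Cauchy's estimate on radius
  -- `r > ρ'` gives a geometric majorant independent of `i`; on a radius below `ε` it sends each
  -- term to `0`. Dominated convergence then handles the sum.
  set a : ι → ℕ → ℝ := fun i n => ‖iteratedDeriv n (h i) c‖ / n.factorial * ρ' ^ n with ha
  have ha0 : ∀ i n, 0 ≤ a i n := fun i n => by positivity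
  have hbound : ∀ᶠ i in l, ∀ n, ‖a i n‖ ≤ C * (ρ' / r) ^ n := by
    filter_upwards [hd, hb] with i hdi hbi n
    rw [Real.norm_of_nonneg (ha0 i n)]
    have h1 := Complex.norm_iteratedDeriv_le_of_forall_mem_sphere_norm_le n hr0
      (dcl hr0 hr i hdi) (fun w hw => hbi w (sph hr hw))
    have hf : (0 : ℝ) < n.factorial := by positivity
    calc ‖iteratedDeriv n (h i) c‖ / n.factorial * ρ' ^ n
        ≤ (n.factorial * C / r ^ n) / n.factorial * ρ' ^ n := by gcongr
      _ = C * (ρ' / r) ^ n := by rw [div_pow]; field_simp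
  have hsum : Summable fun n : ℕ => C * (ρ' / r) ^ n :=
    (summable_geometric_of_lt_one (by positivity) ((div_lt_one hr0).2 hr')).mul_left C
  have hlim : ∀ n, Tendsto (fun i => a i n) l (𝓝 0) := by
    intro n
    obtain ⟨t, ht0, ht⟩ := exists_between (lt_min hε (hρ'.trans hρ))
    have htε := ht.trans_le (min_le_left _ _)
    have htρ := ht.trans_le (min_le_right _ _)
    rw [Metric.tendsto_nhds]
    intro e he
    set η : ℝ := e / 2 * t ^ n / ρ' ^ n with hη
    have hη0 : 0 < η := by positivity
    have := (Metric.tendsto_nhds.1 h0) η hη0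
    rw [eventually_prod_principal_iff] at this
    filter_upwards [hd, this] with i hdi hi
    have h1 := Complex.norm_iteratedDeriv_le_of_forall_mem_sphere_norm_le n ht0
      (dcl ht0 htρ i hdi) (C := η) (fun w hw => by
        have := hi w (by rw [Metric.mem_sphere] at hw; rw [Metric.mem_ball]; linarith)
        rw [dist_zero_right] at this
        exact this.le)
    rw [dist_zero_right, Real.norm_of_nonneg (ha0 i n)]
    have hf : (0 : ℝ) < n.factorial := by positivity
    calc ‖iteratedDeriv n (h i) c‖ / n.factorial * ρ' ^ n
        ≤ (n.factorial * η / t ^ n) / n.factorial * ρ' ^ n := by gcongr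
      _ = e / 2 := by rw [hη]; field_simp
      _ < e := by linarith
  have hS := tendsto_tsum_of_dominated_convergence hsum hlim hbound
  rw [tsum_zero] at hS
  rw [Metric.tendsto_nhds]
  intro e he
  rw [eventually_prod_principal_iff]
  filter_upwards [hd, hbound, (Metric.tendsto_nhds.1 hS) e he] with i hdi hbi hi w hw
  have hsa : Summable (a i) := Summable.of_norm_bounded hsum hbi
  have hw' : ‖w - c‖ < ρ' := by rwa [Metric.mem_ball, dist_eq_norm] at hw
  have hT := Complex.hasSum_taylorSeries_on_ball (f := h i) (c := c) (r := ρ)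
    (fun w hw => (hdi w hw).differentiableWithinAt) (Metric.ball_subset_ball hρ.le hw)
  rw [dist_zero_right] at hi ⊢
  have hn : ‖∑' n, a i n‖ = ∑' n, a i n := Real.norm_of_nonneg (tsum_nonneg (ha0 i))
  rw [hn] at hi
  refine lt_of_le_of_lt ?_ hi
  rw [← hT.tsum_eq]
  refine tsum_of_norm_bounded hsa.hasSum fun n => ?_
  simp only [norm_smul, norm_inv, norm_pow, Complex.norm_natCast, ha]
  have hf : (0 : ℝ) < n.factorial := by positivity
  calc (n.factorial : ℝ)⁻¹ * (‖w - c‖ ^ n * ‖iteratedDeriv n (h i) c‖)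
      ≤ (n.factorial : ℝ)⁻¹ * (ρ' ^ n * ‖iteratedDeriv n (h i) c‖) := by gcongr
    _ = _ := by field_simp

theorem tendsto_coe_nhds_coe {α : Type*} {F : Filter α} {g : α → ℂ} {L : ℂ} :
    Tendsto (fun x => (g x : OnePoint ℂ)) F (𝓝 (L : OnePoint ℂ)) ↔ Tendsto g F (𝓝 L) := by
  rw [← OnePoint.comap_coe_nhds L, tendsto_comap_iff]; rfl

theorem tendsto_coe_nhds_infty {α : Type*} {F : Filter α} {g : α → ℂ} :
    Tendsto (fun x => (g x : OnePoint ℂ)) F (𝓝 OnePoint.infty) ↔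
      Tendsto g F (Bornology.cobounded ℂ) := by
  rw [Metric.cobounded_eq_cocompact, ← coclosedCompact_eq_cocompact,
    ← OnePoint.comap_coe_nhds_infty, tendsto_comap_iff]
  rfl

/-- A limit on the Riemann sphere of a family with bounded spherical derivatives propagates from
arbitrarily small discs to a concentric disc of controlled radius. -/
theorem exists_radius_tendsto (L : OnePoint ℂ) (M : ℝ) {R : ℝ} (hR : 0 < R) :
    ∃ ρ > 0, ∀ {g : ι → ℂ → ℂ} {c : ℂ} {ε : ℝ}, 0 < ε →
      (∀ᶠ i in l, ∀ w ∈ ball c R, DifferentiableAt ℂ (g i) w) →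
      (∀ᶠ i in l, ∀ w ∈ ball c R, ‖deriv (g i) w‖ ≤ M * (1 + ‖g i w‖ ^ 2)) →
      Tendsto (fun p : ι × ℂ => (g p.1 p.2 : OnePoint ℂ)) (l ×ˢ 𝓟 (ball c ε)) (𝓝 L) →
      Tendsto (fun p : ι × ℂ => (g p.1 p.2 : OnePoint ℂ)) (l ×ˢ 𝓟 (ball c ρ)) (𝓝 L) := by
  set N : ℝ := |M| + 1
  have hN : 0 < N := by positivity
  have hMN : M ≤ N := (le_abs_self M).trans (by simp [N])
  -- the Lipschitz estimate from the centre
  have lip : ∀ {g : ℂ → ℂ} {c : ℂ} {δ : ℝ}, (∀ w ∈ ball c R, DifferentiableAt ℂ g w) →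
      (∀ w ∈ ball c R, ‖deriv g w‖ ≤ M * (1 + ‖g w‖ ^ 2)) →
      ∀ w ∈ ball c (min R (δ / N)), |(1 + ‖g w‖ ^ 2)⁻¹ - (1 + ‖g c‖ ^ 2)⁻¹| ≤ δ := by
    intro g c δ hd hM w hw
    rw [Metric.mem_ball, lt_min_iff, lt_div_iff₀ hN, dist_eq_norm] at hw
    have := abs_inv_one_add_sq_sub_le (convex_ball c R) hd hM (Metric.mem_ball_self hR)
      (w₂ := w) (by rw [Metric.mem_ball, dist_eq_norm]; exact hw.1)
    refine this.trans ?_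
    nlinarith [norm_nonneg (w - c)]
  have centre : ∀ {g : ι → ℂ → ℂ} {c : ℂ} {ε : ℝ} {F : Filter ℂ}, 0 < ε →
      Tendsto (fun p : ι × ℂ => g p.1 p.2) (l ×ˢ 𝓟 (ball c ε)) F →
      Tendsto (fun i => g i c) l F := by
    intro g c ε F hε h
    refine h.comp (tendsto_id.prodMk (tendsto_principal.2 (Eventually.of_forall fun _ => ?_)))
    exact Metric.mem_ball_self hε
  induction L using OnePoint.rec with
  | coe L =>
    -- Once `|g(c)| ≤ |L| + 1`, the quantity `1 / (1 + |g|²)` is at least `v` at the centre and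
    -- drops by at most `v/2` on the disc of radius `ρ`, which bounds `g` there. This `ρ` does not
    -- depend on `ε`.
    set v : ℝ := (1 + (‖L‖ + 1) ^ 2)⁻¹ with hv
    have hv0 : 0 < v := by positivity
    set ρ := min R (v / 2 / N) with hρ
    have hρ0 : 0 < ρ := lt_min hR (by positivity)
    refine ⟨ρ / 2, by positivity, ?_⟩
    intro g c ε hε hd hM hlim
    rw [tendsto_coe_nhds_coe] at hlim ⊢
    rw [← tendsto_sub_nhds_zero_iff] at hlim ⊢
    have hb : ∀ᶠ i in l, ∀ w ∈ ball c ρ, ‖g i w‖ ≤ 2 / v := by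
      have h1 := (Metric.tendsto_nhds.1 (centre (g := fun i w => g i w - L) hε hlim)) 1 one_pos
      filter_upwards [hd, hM, h1] with i hdi hMi hi w hw
      rw [dist_zero_right] at hi
      have h2 : ‖g i c‖ ≤ ‖L‖ + 1 := by
        have := norm_add_le (g i c - L) L
        rw [sub_add_cancel] at this; linarith
      have h3 : v ≤ (1 + ‖g i c‖ ^ 2)⁻¹ := by rw [hv]; gcongr
      have h4 := (abs_le.1 (lip (δ := v / 2) hdi hMi w hw)).1
      have h5 : v / 2 ≤ (1 + ‖g i w‖ ^ 2)⁻¹ := by linarith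
      have h6 := (le_inv_comm₀ (by positivity) (by positivity)).1 h5
      rw [inv_div] at h6
      nlinarith [sq_nonneg (‖g i w‖ - 1), norm_nonneg (g i w)]
    refine tendsto_zero_of_bounded (h := fun i w => g i w - L) (ρ := ρ) (C := 2 / v + ‖L‖) hε
      (by positivity) (by linarith) ?_ ?_ hlim
    · filter_upwards [hd] with i hi w hw
      exact (hi w (Metric.ball_subset_ball (min_le_left _ _) hw)).sub_const L
    · filter_upwards [hb] with i hi w hw
      exact (norm_sub_le _ _).trans (by linarith [hi w hw])
  | infty =>
    -- Once `|g(c)| ≥ 2`, `1 / (1 + |g|²)` rises from at most `1/4` to at most `1/2`, so `|g| ≥ 1`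
    -- on the disc and `1/g` is holomorphic and bounded by `1`.
    set ρ := min R (1 / 4 / N) with hρ
    have hρ0 : 0 < ρ := lt_min hR (by positivity)
    refine ⟨ρ / 2, by positivity, ?_⟩
    intro g c ε hε hd hM hlim
    rw [tendsto_coe_nhds_infty] at hlim ⊢
    have hb : ∀ᶠ i in l, ∀ w ∈ ball c ρ, 1 ≤ ‖g i w‖ := by
      have h1 := (tendsto_norm_cobounded_atTop.comp (centre hε hlim)).eventually_ge_atTop 2
      filter_upwards [hd, hM, h1] with i hdi hMi hi w hw
      have h2 : 2 ≤ ‖g i c‖ := hi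
      have h3 : (1 + ‖g i c‖ ^ 2)⁻¹ ≤ 1 / 4 := by
        rw [one_div]; gcongr; nlinarith
      have h4 := (abs_le.1 (lip (δ := 1 / 4) hdi hMi w hw)).2
      have h5 : (1 + ‖g i w‖ ^ 2)⁻¹ ≤ 1 / 2 := by linarith
      have h6 := (inv_le_comm₀ (by positivity) (by positivity)).1 h5
      norm_num at h6
      nlinarith [norm_nonneg (g i w)]
    have h0 : Tendsto (fun p : ι × ℂ => (g p.1 p.2)⁻¹) (l ×ˢ 𝓟 (ball c (ρ / 2))) (𝓝 0) := by
      refine tendsto_zero_of_bounded (h := fun i w => (g i w)⁻¹) (ρ := ρ) (C := 1) hε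
        (by positivity) (by linarith) ?_ ?_ (tendsto_inv₀_cobounded.comp hlim)
      · filter_upwards [hd, hb] with i hi hi' w hw
        refine (hi w (Metric.ball_subset_ball (min_le_left _ _) hw)).inv ?_
        exact norm_pos_iff.1 (one_pos.trans_le (hi' w hw))
      · filter_upwards [hb] with i hi w hw
        rw [norm_inv]
        exact inv_le_one_of_one_le₀ (hi w hw)
    have hne : ∀ᶠ p in l ×ˢ 𝓟 (ball c (ρ / 2)), (g p.1 p.2)⁻¹ ∈ ({0}ᶜ : Set ℂ) := by
      rw [eventually_prod_principal_iff]
      filter_upwards [hb] with i hi w hw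
      have := hi w (Metric.ball_subset_ball (by linarith) hw)
      simpa using norm_pos_iff.1 (one_pos.trans_le this)
    have := tendsto_inv₀_nhdsNE_zero.comp (tendsto_nhdsWithin_iff.2 ⟨h0, hne⟩)
    simpa [Function.comp_def] using this

/-- Propagation along the segment `[0, 1]` of a limit on the Riemann sphere, for a family of
functions holomorphic with bounded spherical derivatives near the segment. -/
theorem tendsto_one_of_tendsto_ball_zero {g : ι → ℂ → ℂ} {L : OnePoint ℂ} {M R ε : ℝ}
    (hR : 0 < R) (hε : 0 < ε)
    (hd : ∀ᶠ i in l, ∀ s ∈ Set.Icc (0 : ℝ) 1, ∀ w ∈ ball (s : ℂ) R, DifferentiableAt ℂ (g i) w)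
    (hM : ∀ᶠ i in l, ∀ s ∈ Set.Icc (0 : ℝ) 1, ∀ w ∈ ball (s : ℂ) R,
      ‖deriv (g i) w‖ ≤ M * (1 + ‖g i w‖ ^ 2))
    (hlim : Tendsto (fun p : ι × ℂ => (g p.1 p.2 : OnePoint ℂ)) (l ×ˢ 𝓟 (ball 0 ε)) (𝓝 L)) :
    Tendsto (fun i => (g i 1 : OnePoint ℂ)) l (𝓝 L) := by
  obtain ⟨ρ, hρ, key⟩ := exists_radius_tendsto (l := l) L M hR
  -- The radius `ε` may be tiny, but each application of `key` restores the fixed radius `ρ`, so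
  -- centres can advance by `ρ/2` each time.
  have step : ∀ k : ℕ, ∀ s ∈ Set.Icc (0 : ℝ) 1, s ≤ k * (ρ / 2) → ∃ e > 0,
      Tendsto (fun p : ι × ℂ => (g p.1 p.2 : OnePoint ℂ)) (l ×ˢ 𝓟 (ball (s : ℂ) e)) (𝓝 L) := by
    intro k
    induction k with
    | zero =>
      intro s hs hs'
      obtain rfl : s = 0 := le_antisymm (by simpa using hs') hs.1
      exact ⟨ε, hε, by simpa using hlim⟩
    | succ k ih =>
      intro s hs hs'
      push_cast at hs'
      set s' := max 0 (s - ρ / 2) with hs'_def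
      have h1 : s' ∈ Set.Icc (0 : ℝ) 1 := ⟨le_max_left _ _, max_le zero_le_one (by linarith [hs.2])⟩
      obtain ⟨e, he, h2⟩ := ih s' h1 (max_le (by positivity) (by linarith))
      have h3 := key he (hd.mono fun i hi => hi s' h1) (hM.mono fun i hi => hi s' h1) h2
      refine ⟨ρ / 2, by positivity, h3.mono_left (prod_mono le_rfl (principal_mono.2 ?_))⟩
      refine Metric.ball_subset_ball' ?_
      rw [Complex.dist_eq, ← Complex.ofReal_sub, Complex.norm_real, Real.norm_eq_abs]
      have : |s - s'| ≤ ρ / 2 := by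
        rw [abs_le]
        rcases max_cases 0 (s - ρ / 2) with h | h <;> constructor <;>
          linarith [h.1, h.2, hs.1, hs.2]
      linarith
  obtain ⟨k, hk⟩ := exists_nat_ge (1 / (ρ / 2))
  rw [div_le_iff₀ (by positivity)] at hk
  obtain ⟨e, he, h⟩ := step k 1 ⟨zero_le_one, le_rfl⟩ hk
  refine h.comp (tendsto_id.prodMk (tendsto_principal.2 (Eventually.of_forall fun _ => ?_)))
  simpa using he

/-! ### Second-order estimates for a `C²` function at a critical zero -/

section SecondOrder

variable {E : Type*} [NormedAddCommGroup E] [NormedSpace ℝ E] {ψ : E → ℝ}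

/-- Near a critical point the gradient of a `C²` function grows at most linearly. -/
theorem exists_norm_fderiv_le (hψ : ContDiffAt ℝ 2 ψ 0) (hd : fderiv ℝ ψ 0 = 0) :
    ∃ C > 0, ∃ r > 0, ∀ v, ‖v‖ < r → DifferentiableAt ℝ ψ v ∧ ‖fderiv ℝ ψ v‖ ≤ C * ‖v‖ := by
  have h1 : ContDiffAt ℝ 1 (fderiv ℝ ψ) 0 := hψ.fderiv_right (by norm_num)
  obtain ⟨K, t, ht, hK⟩ := h1.exists_lipschitzOnWith
  have h2 : ∀ᶠ v in 𝓝 (0 : E), DifferentiableAt ℝ ψ v :=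
    (hψ.eventually (by simp)).mono fun v hv => hv.differentiableAt (by norm_num)
  obtain ⟨r, hr, h⟩ := Metric.eventually_nhds_iff.1 (h2.and ht)
  refine ⟨K + 1, by positivity, r, hr, fun v hv => ?_⟩
  obtain ⟨h3, h4⟩ := h (by simpa using hv)
  refine ⟨h3, ?_⟩
  have := hK.dist_le_mul v h4 0 (mem_of_mem_nhds ht)
  rw [hd, dist_zero_right, dist_zero_right] at this
  nlinarith [norm_nonneg v]

/-- Mean value inequality on the ball of radius `t`, where the gradient is at most `Ct`. With `t`
comparable to `|ζ|`, it turns displacements of order `|ζ|` into changes of order `|ζ|² = O(d)`. -/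
theorem exists_abs_sub_le (hψ : ContDiffAt ℝ 2 ψ 0) (hd : fderiv ℝ ψ 0 = 0) :
    ∃ C > 0, ∃ r > 0, ∀ t < r, ∀ u v, ‖u‖ ≤ t → ‖v‖ ≤ t → |ψ u - ψ v| ≤ C * t * ‖u - v‖ := by
  obtain ⟨C, hC, r, hr, h⟩ := exists_norm_fderiv_le hψ hd
  refine ⟨C, hC, r, hr, fun t ht u v hu hv => ?_⟩
  have hm : ∀ w ∈ Metric.closedBall (0 : E) t, ‖w‖ ≤ t := fun w hw => by simpa using hw
  refine (convex_closedBall (0 : E) t).norm_image_sub_le_of_norm_fderiv_le (𝕜 := ℝ)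
    (fun w hw => (h w ((hm w hw).trans_lt ht)).1) (fun w hw => ?_) (by simpa using hv)
    (by simpa using hu)
  exact (h w ((hm w hw).trans_lt ht)).2.trans (by gcongr; exact hm w hw)

/-- Near a critical zero a `C²` function is almost homogeneous of degree two. -/
theorem exists_abs_smul_sub_le (hψ : ContDiffAt ℝ 2 ψ 0) (h0 : ψ 0 = 0)
    (hd : fderiv ℝ ψ 0 = 0) {δ : ℝ} (hδ : 0 < δ) :
    ∃ r > 0, ∀ v, ‖v‖ < r → ∀ s ∈ Set.Icc (0 : ℝ) 1, |ψ (s • v) - s ^ 2 * ψ v| ≤ δ * ‖v‖ ^ 2 := by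
  have h1 : ContDiffAt ℝ 1 (fderiv ℝ ψ) 0 := hψ.fderiv_right (by norm_num)
  set A := fderiv ℝ (fderiv ℝ ψ) 0
  have h2 : HasFDerivAt (fderiv ℝ ψ) A 0 := (h1.differentiableAt (by norm_num)).hasFDerivAt
  have h3 := (hasFDerivAt_iff_isLittleO.1 h2).def (half_pos hδ)
  have h4 : ∀ᶠ v in 𝓝 (0 : E), DifferentiableAt ℝ ψ v :=
    (hψ.eventually (by simp)).mono fun v hv => hv.differentiableAt (by norm_num)
  obtain ⟨r, hr, h⟩ := Metric.eventually_nhds_iff.1 (h3.and h4)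
  refine ⟨r, hr, fun v hv => ?_⟩
  -- The `s`-derivative of the difference is `(∇ψ(sv) - A(sv))v`, which is `o(|v|²)` uniformly in
  -- `s` by differentiability of `∇ψ` at `0`. Comparing `s` with `1` afterwards eliminates `A`.
  have key : ∀ s ∈ Set.Icc (0 : ℝ) 1, |ψ (s • v) - s ^ 2 / 2 * A v v| ≤ δ / 2 * ‖v‖ ^ 2 := by
    have hs : ∀ s ∈ Set.Icc (0 : ℝ) 1, ‖s • v‖ ≤ ‖v‖ := fun s hs => by
      rw [norm_smul, Real.norm_of_nonneg hs.1]
      exact mul_le_of_le_one_left (norm_nonneg _) hs.2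
    have hsr : ∀ s ∈ Set.Icc (0 : ℝ) 1, dist (s • v) 0 < r := fun s hs' => by
      rw [dist_zero_right]; exact (hs s hs').trans_lt hv
    have hder : ∀ s ∈ Set.Icc (0 : ℝ) 1, HasDerivWithinAt (fun s : ℝ => ψ (s • v) - s ^ 2 / 2 * A v v)
        ((fderiv ℝ ψ (s • v) - A (s • v)) v) (Set.Icc 0 1) s := by
      intro s hs'
      have e1 : HasDerivAt (fun s : ℝ => s • v) v s := by
        simpa using (hasDerivAt_id s).smul_const v
      have e2 := (h (hsr s hs')).2.hasFDerivAt.comp_hasDerivAt s e1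
      have e3 := (((hasDerivAt_id s).pow 2).div_const 2).mul_const (A v v)
      refine ((e2.sub e3).congr_deriv ?_).hasDerivWithinAt
      simp
    have hb : ∀ s ∈ Set.Ico (0 : ℝ) 1,
        ‖(fderiv ℝ ψ (s • v) - A (s • v)) v‖ ≤ δ / 2 * ‖v‖ ^ 2 := by
      intro s hs'
      have hs1 : s ∈ Set.Icc (0 : ℝ) 1 := ⟨hs'.1, hs'.2.le⟩
      have e1 := (h (hsr s hs1)).1
      rw [hd, sub_zero, sub_zero] at e1
      calc _ ≤ ‖fderiv ℝ ψ (s • v) - A (s • v)‖ * ‖v‖ := ContinuousLinearMap.le_opNorm _ _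
        _ ≤ (δ / 2 * ‖v‖) * ‖v‖ := by
          gcongr
          exact e1.trans (by gcongr; exact hs s hs1)
        _ = _ := by ring
    intro s hs'
    have := norm_image_sub_le_of_norm_deriv_le_segment' hder hb s hs'
    simp only [zero_smul, h0, sub_zero, Real.norm_eq_abs] at this
    have e0 : ((0 : ℝ) ^ 2 / 2 * A v v) = 0 := by ring
    rw [e0, sub_zero, sub_zero] at this
    refine this.trans (mul_le_of_le_one_right (by positivity) hs'.2)
  intro s hs
  have e1 := key s hs
  have e2 := key 1 ⟨zero_le_one, le_rfl⟩
  rw [one_smul] at e2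
  have e3 : ψ (s • v) - s ^ 2 * ψ v =
      (ψ (s • v) - s ^ 2 / 2 * A v v) - s ^ 2 * (ψ v - 1 ^ 2 / 2 * A v v) := by ring
  have hs2 : s ^ 2 ≤ 1 := pow_le_one₀ hs.1 hs.2
  rw [e3]
  refine (abs_sub _ _).trans ?_
  rw [abs_mul, abs_of_nonneg (sq_nonneg s)]
  nlinarith [abs_nonneg (ψ v - 1 ^ 2 / 2 * A v v)]

end SecondOrder

/-! ### Coordinates adapted to the normal at the vertex -/

variable {n : ℕ} {D : Set (Cn n)} {ξ ν : Cn n} {ψ : Cn n → ℝ}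

theorem re_normalCoord (ξ ν z : Cn n) :
    (normalCoord ξ ν z).re = -(inner ℂ ν (z - ξ)).re := by
  rw [normalCoord, inner_neg_left, Complex.neg_re]

theorem re_inner_comm (u v : Cn n) : (inner ℂ u v : ℂ).re = (inner ℂ v u : ℂ).re :=
  inner_re_symm (𝕜 := ℂ) u v

theorem abs_re_normalCoord_le (hν : ‖ν‖ = 1) (z : Cn n) :
    |(normalCoord ξ ν z).re| ≤ ‖z - ξ‖ := by
  refine (Complex.abs_re_le_norm _).trans ((norm_inner_le_norm _ _).trans ?_)
  rw [norm_neg, hν, one_mul]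

theorem inner_self_of_unit (hν : ‖ν‖ = 1) : inner ℂ ν ν = (1 : ℂ) := by
  rw [inner_self_eq_norm_sq_to_K, hν]; simp

theorem inner_real_smul_right' (ν v : Cn n) (t : ℝ) :
    inner ℂ ν (t • v) = (t : ℂ) * inner ℂ ν v := by
  rw [← inner_smul_right, Complex.coe_smul]

/-- The real orthogonal projection to the tangent hyperplane does not increase norms. -/
theorem norm_sub_re_inner_smul_le (hν : ‖ν‖ = 1) (v : Cn n) :
    ‖v - (inner ℂ ν v).re • ν‖ ≤ ‖v‖ := by
  have h := norm_sub_sq (𝕜 := ℂ) v ((inner ℂ ν v).re • ν)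
  have h2 : RCLike.re (inner ℂ v ((inner ℂ ν v).re • ν)) = (inner ℂ ν v).re ^ 2 := by
    rw [inner_real_smul_right']
    simp [pow_two, re_inner_comm v ν]
  rw [h2, norm_smul, hν, mul_one, Real.norm_eq_abs, sq_abs] at h
  refine abs_le_of_sq_le_sq' ?_ (norm_nonneg _) |>.2
  nlinarith [sq_nonneg (inner ℂ ν v).re]

theorem tangentialPart_eq (ξ ν z : Cn n) :
    tangentialPart ξ ν z = (z - ξ) - (inner ℂ ν (z - ξ)).re • ν := by
  rw [tangentialPart, re_normalCoord, neg_smul, sub_eq_add_neg (z - ξ)]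

theorem norm_tangentialPart_le (hν : ‖ν‖ = 1) (z : Cn n) :
    ‖tangentialPart ξ ν z‖ ≤ ‖z - ξ‖ := by
  rw [tangentialPart_eq]; exact norm_sub_re_inner_smul_le hν _

theorem inner_tangentialPart (hν : ‖ν‖ = 1) (z : Cn n) :
    inner ℂ ν (tangentialPart ξ ν z) = -(((normalCoord ξ ν z).im : ℂ) * Complex.I) := by
  rw [tangentialPart_eq, inner_sub_right, inner_real_smul_right', inner_self_of_unit hν, mul_one]
  rw [normalCoord, inner_neg_left]
  generalize (inner ℂ ν (z - ξ) : ℂ) = a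
  apply Complex.ext <;> simp

theorem abs_im_normalCoord_le (hν : ‖ν‖ = 1) (z : Cn n) :
    |(normalCoord ξ ν z).im| ≤ ‖tangentialPart ξ ν z‖ := by
  have h := norm_inner_le_norm (𝕜 := ℂ) ν (tangentialPart ξ ν z)
  rw [inner_tangentialPart hν, hν, one_mul] at h
  simpa using h

theorem re_normalCoord_add_smul (z v : Cn n) (t : ℝ) :
    (normalCoord ξ ν (z + t • v)).re = (normalCoord ξ ν z).re - t * (inner ℂ ν v).re := by
  rw [re_normalCoord, re_normalCoord, add_sub_right_comm, inner_add_right, inner_real_smul_right',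
    Complex.add_re, Complex.re_ofReal_mul]
  ring

theorem tangentialPart_add_smul (z v : Cn n) (t : ℝ) :
    tangentialPart ξ ν (z + t • v) =
      tangentialPart ξ ν z + t • (v - (inner ℂ ν v).re • ν) := by
  rw [tangentialPart, tangentialPart, re_normalCoord_add_smul]
  module

theorem tangentialPart_self (ξ ν : Cn n) : tangentialPart ξ ν ξ = 0 := by
  simp [tangentialPart, normalCoord]

theorem normalCoord_self (ξ ν : Cn n) : normalCoord ξ ν ξ = 0 := by
  simp [normalCoord]

/-! ### Variation of the normal and transfer of the derivative bounds -/

/-- From a boundary point, directions pointing strictly inwards lead into the domain. -/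
theorem IsC2GraphAt.eventually_add_smul_mem (hψ : IsC2GraphAt D ξ ν ψ) {v : Cn n}
    (hv : (inner ℂ ν v).re < 0) : ∀ᶠ t : ℝ in 𝓝[>] 0, ξ + t • v ∈ D := by
  set w := v - (inner ℂ ν v).re • ν with hw
  have hd : HasDerivAt (fun t : ℝ => ψ (t • w)) 0 0 := by
    have e1 : HasDerivAt (fun t : ℝ => t • w) w 0 := by
      simpa using (hasDerivAt_id (0 : ℝ)).smul_const w
    have e0 : HasFDerivAt ψ (0 : Cn n →L[ℝ] ℝ) ((0 : ℝ) • w) := by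
      rw [zero_smul, ← hψ.fderiv_zero]
      exact (hψ.contDiffAt.differentiableAt (by norm_num)).hasFDerivAt
    exact (e0.comp_hasDerivAt 0 e1).congr_deriv (by simp)
  have h1 := (hasDerivAt_iff_isLittleO.1 hd).def (half_pos (neg_pos.2 hv))
  have hc : Tendsto (fun t : ℝ => ξ + t • v) (𝓝 0) (𝓝 ξ) := by
    have : Continuous (fun t : ℝ => ξ + t • v) := by fun_prop
    simpa using this.tendsto 0
  filter_upwards [nhdsWithin_le_nhds h1, nhdsWithin_le_nhds (hc.eventually hψ.mem_iff),
    self_mem_nhdsWithin] with t h2 h3 ht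
  have ht : 0 < t := ht
  rw [h3, tangentialPart_add_smul, re_normalCoord_add_smul, tangentialPart_self, normalCoord_self,
    zero_add, ← hw, Complex.zero_re]
  simp only [zero_smul, hψ.map_zero, sub_zero, smul_zero, Real.norm_eq_abs, abs_of_pos ht] at h2
  have := (abs_le.1 h2).2
  nlinarith [mul_pos ht (neg_pos.2 hv)]

/-- The unit outer normal varies in a Lipschitz way at a `C²` boundary point. -/
theorem IsC2GraphAt.exists_norm_normal_sub_le (hψ : IsC2GraphAt D ξ ν ψ) (hDo : IsOpen D) :
    ∃ C > 0, ∀ᶠ ζ in 𝓝 ξ, ζ ∈ frontier D → ∀ ν', IsOuterUnitNormal D ζ ν' →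
      ‖ν' - ν‖ ≤ C * ‖ζ - ξ‖ := by
  have hν := hψ.norm_normal
  obtain ⟨C, hC, r, hr, h⟩ := exists_norm_fderiv_le hψ.contDiffAt hψ.fderiv_zero
  refine ⟨2 * C, by positivity, ?_⟩
  filter_upwards [hψ.mem_iff.eventually_nhds, hψ.mem_iff, Metric.ball_mem_nhds ξ hr] with
    ζ hζ hζ' hζr hζD ν' ⟨ψ', hψ'⟩
  have hν' := hψ'.norm_normal
  rw [Metric.mem_ball, dist_eq_norm] at hζr
  rcases eq_or_ne ν ν' with rfl | hne
  · rw [sub_self, norm_zero]; positivity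
  -- This direction points strictly inwards for `ν'` but outwards for `ν`. Moving from `ζ` along it
  -- enters `D` while `x₁` decreases at rate `|v|²/2`, so `ψ` must decrease at least as fast; its
  -- gradient there is only `O(|ζ - ξ|)`, whence `|v| = O(|ζ - ξ|)`.
  set v := ν - ν' with hv
  have hv0 : 0 < ‖v‖ := norm_pos_iff.2 (sub_ne_zero.2 hne)
  have hsq : ‖v‖ ^ 2 = 2 - 2 * (inner ℂ ν ν').re := by
    have := norm_sub_sq (𝕜 := ℂ) ν ν'
    rw [hν, hν'] at this
    rw [this]; simp; ring
  have i1 : (inner ℂ ν v).re = ‖v‖ ^ 2 / 2 := by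
    rw [hsq, hv, inner_sub_right, inner_self_of_unit hν]; simp; ring
  have i2 : (inner ℂ ν' v).re < 0 := by
    have : (inner ℂ ν' v).re = -(‖v‖ ^ 2 / 2) := by
      rw [hsq, hv, inner_sub_right, inner_self_of_unit hν', Complex.sub_re,
        re_inner_comm ν' ν]; simp; ring
    rw [this]
    have : 0 < ‖v‖ ^ 2 := by positivity
    linarith
  have hin := hψ'.eventually_add_smul_mem i2
  set w := v - (inner ℂ ν v).re • ν with hw
  set a := tangentialPart ξ ν ζ with ha
  have har : ‖a‖ ≤ ‖ζ - ξ‖ := norm_tangentialPart_le hν ζ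
  obtain ⟨hda, hCa⟩ := h a (har.trans_lt hζr)
  have hder : HasDerivAt (fun t : ℝ => ψ (a + t • w)) (fderiv ℝ ψ a w) 0 := by
    have e1 : HasDerivAt (fun t : ℝ => a + t • w) w 0 := by
      simpa using ((hasDerivAt_id (0 : ℝ)).smul_const w).const_add a
    have e0 : HasFDerivAt ψ (fderiv ℝ ψ a) (a + (0 : ℝ) • w) := by
      rw [zero_smul, add_zero]; exact hda.hasFDerivAt
    exact e0.comp_hasDerivAt 0 e1
  have hslope := (hasDerivAt_iff_tendsto_slope.1 hder).mono_left
    (nhdsWithin_mono (0 : ℝ) (s := Set.Ioi 0) fun t ht => (ne_of_gt ht))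
  have hnot : ζ ∉ D := fun hmem => by
    rw [hDo.frontier_eq] at hζD; exact hζD.2 hmem
  have hle0 : (normalCoord ξ ν ζ).re ≤ ψ a := by
    by_contra hlt; exact hnot (hζ'.2 (not_le.1 hlt))
  have hc : Tendsto (fun t : ℝ => ζ + t • v) (𝓝 0) (𝓝 ζ) := by
    have : Continuous (fun t : ℝ => ζ + t • v) := by fun_prop
    simpa using this.tendsto 0
  have hle : fderiv ℝ ψ a w ≤ -(‖v‖ ^ 2 / 2) := by
    refine le_of_tendsto hslope ?_
    filter_upwards [hin, nhdsWithin_le_nhds (hc.eventually hζ), self_mem_nhdsWithin] with t h1 h2 ht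
    have ht : 0 < t := ht
    have h3 := h2.1 h1
    rw [tangentialPart_add_smul, re_normalCoord_add_smul, ← ha, ← hw, i1] at h3
    rw [slope_def_field, sub_zero, zero_smul, add_zero, div_le_iff₀ ht]
    linarith
  have hge : |fderiv ℝ ψ a w| ≤ C * ‖ζ - ξ‖ * ‖v‖ :=
    ((fderiv ℝ ψ a).le_opNorm w).trans (by
      gcongr
      · exact hCa.trans (by gcongr)
      · exact norm_sub_re_inner_smul_le hν v)
  have h5 : ‖v‖ ^ 2 / 2 ≤ C * ‖ζ - ξ‖ * ‖v‖ := by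
    have := (abs_le.1 hge).1; linarith
  rw [← norm_sub_rev, ← hv]
  by_contra hlt
  nlinarith [not_le.1 hlt]

theorem graphDist_pos_of_mem {α : ℝ} (hα : 0 < α) {z : Cn n}
    (hz : z ∈ approachRegion D ξ ν ψ α) : 0 < graphDist ξ ν ψ z :=
  pos_of_mul_pos_right ((sq_nonneg _).trans_lt hz.2.1) hα.le

/-- In an approach region, the bounds on the spherical derivative in directions that are normal or
tangential at the closest boundary point give bounds in terms of the normal at the vertex. -/
theorem exists_norm_fderiv_le_of_sphericalDerivBounds (hDo : IsOpen D) (hD : HasC2Boundary D)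
    (hξ : ξ ∈ frontier D) (hψ : IsC2GraphAt D ξ ν ψ) {f : Cn n → ℂ} {α K : ℝ} (hα : 0 < α)
    (hK : ∀ᶠ z in 𝓝[approachRegion D ξ ν ψ α] ξ,
      SphericalDerivBounds D f z (K / graphDist ξ ν ψ z) (K / √(graphDist ξ ν ψ z))) :
    ∃ M ≥ 0, ∀ᶠ z in 𝓝[approachRegion D ξ ν ψ α] ξ, ∀ v : Cn n,
      ‖fderiv ℂ f z v‖ ≤
        M * (‖inner ℂ ν v‖ / graphDist ξ ν ψ z + ‖v‖ / √(graphDist ξ ν ψ z)) *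
          (1 + ‖f z‖ ^ 2) := by
  obtain ⟨C, hC, hnear⟩ := hψ.exists_norm_normal_sub_le hDo
  obtain ⟨r, hr, hnear⟩ := Metric.eventually_nhds_iff.1 hnear
  refine ⟨|K| * (2 + 2 * C * √α), by positivity, ?_⟩
  filter_upwards [hK, self_mem_nhdsWithin,
    nhdsWithin_le_nhds (Metric.ball_mem_nhds ξ (half_pos hr))] with z hKz hz hzr v
  have hd := graphDist_pos_of_mem hα hz
  have hsq := hz.2.1
  set d := graphDist ξ ν ψ z
  rw [Metric.mem_ball] at hzr
  obtain ⟨ζ, hζ, hζd⟩ := isClosed_frontier.exists_infDist_eq_dist ⟨ξ, hξ⟩ z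
  have h1 : dist z ζ ≤ dist z ξ := hζd ▸ Metric.infDist_le_dist_of_mem hξ
  have h2 : dist ζ ξ ≤ 2 * dist z ξ := by
    have := dist_triangle_left ζ ξ z; linarith
  obtain ⟨ν', hν'⟩ := hD ζ hζ
  have h3 := hnear (by linarith) hζ ν' hν'
  obtain ⟨hN, hT⟩ := hKz ζ ν' ⟨hζ, hζd.symm⟩ hν'
  have hu : ‖ν'‖ = 1 := hν'.choose_spec.norm_normal
  set S := 1 + ‖f z‖ ^ 2
  have hS : 0 < S := by positivity
  have hsd : 0 < √d := Real.sqrt_pos.2 hd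
  have hN' : ‖fderiv ℂ f z ν'‖ ≤ |K| / d * S := by
    rw [sphericalDeriv, div_le_iff₀ hS] at hN
    exact hN.trans (by gcongr; exact le_abs_self K)
  set a : ℂ := inner ℂ ν' v with ha
  set w := v - a • ν' with hw
  have hwν : inner ℂ ν' w = (0 : ℂ) := by
    rw [hw, inner_sub_right, inner_smul_right, inner_self_of_unit hu, mul_one, sub_self]
  have hav : ‖a‖ ≤ ‖v‖ := by
    have := norm_inner_le_norm (𝕜 := ℂ) ν' v
    rwa [hu, one_mul] at this
  have hwv : ‖w‖ ≤ 2 * ‖v‖ := by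
    have := norm_sub_le v (a • ν')
    rw [norm_smul, hu, mul_one] at this; linarith
  have hT' : ‖fderiv ℂ f z w‖ ≤ ‖w‖ * (|K| / √d * S) := by
    rcases eq_or_ne w 0 with h0 | h0
    · rw [h0]; simp
    have hw0 : 0 < ‖w‖ := norm_pos_iff.2 h0
    have h5 := hT (((‖w‖⁻¹ : ℝ) : ℂ) • w)
      (by rw [norm_smul, Complex.norm_real, norm_inv, norm_norm, inv_mul_cancel₀ hw0.ne'])
      (by rw [inner_smul_right, hwν, mul_zero])
    rw [sphericalDeriv, div_le_iff₀ hS, map_smul, norm_smul, Complex.norm_real, norm_inv,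
      norm_norm, inv_mul_le_iff₀ hw0] at h5
    exact h5.trans (by gcongr; exact le_abs_self K)
  have hzξ : ‖z - ξ‖ ≤ √α * √d := by
    rw [← Real.sqrt_mul hα.le]; exact Real.le_sqrt_of_sq_le hsq.le
  have hνν : ‖ν' - ν‖ ≤ 2 * C * √α * √d := by
    rw [dist_eq_norm, dist_eq_norm] at h2
    calc ‖ν' - ν‖ ≤ C * ‖ζ - ξ‖ := h3
      _ ≤ C * (2 * (√α * √d)) := by gcongr; linarith
      _ = _ := by ring
  -- Replacing `ν'` by `ν` costs `O(√d)|v|`; multiplied by `K/d` this is `O(|v|/√d)`, the same order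
  -- as the tangential bound.
  have haν : ‖a‖ ≤ ‖inner ℂ ν v‖ + 2 * C * √α * √d * ‖v‖ := by
    have e : a = inner ℂ ν v + inner ℂ (ν' - ν) v := by rw [inner_sub_left]; ring
    rw [e]
    refine (norm_add_le _ _).trans ?_
    gcongr
    exact (norm_inner_le_norm _ _).trans (by gcongr)
  have hdec : v = a • ν' + w := by rw [hw]; abel
  have hdd : √d / d = 1 / √d := by
    rw [div_eq_div_iff hd.ne' hsd.ne', Real.mul_self_sqrt hd.le, one_mul]
  calc ‖fderiv ℂ f z v‖ = ‖a • fderiv ℂ f z ν' + fderiv ℂ f z w‖ := by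
        conv_lhs => rw [hdec]
        rw [map_add, map_smul]
    _ ≤ ‖a‖ * ‖fderiv ℂ f z ν'‖ + ‖fderiv ℂ f z w‖ := by
        rw [← norm_smul]; exact norm_add_le _ _
    _ ≤ (‖inner ℂ ν v‖ + 2 * C * √α * √d * ‖v‖) * (|K| / d * S) +
          2 * ‖v‖ * (|K| / √d * S) := by
        gcongr
        exact hT'.trans (by gcongr)
    _ = |K| * (‖inner ℂ ν v‖ / d + 2 * C * √α * ‖v‖ * (√d / d) + 2 * (‖v‖ / √d)) * S := by ring
    _ = |K| * (1 * (‖inner ℂ ν v‖ / d) + (2 + 2 * C * √α) * (‖v‖ / √d)) * S := by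
        rw [hdd]; ring
    _ ≤ |K| * ((2 + 2 * C * √α) * (‖inner ℂ ν v‖ / d) + (2 + 2 * C * √α) * (‖v‖ / √d)) * S := by
        have : 1 ≤ 2 + 2 * C * √α := by nlinarith [mul_nonneg hC.le (Real.sqrt_nonneg α)]
        gcongr
    _ = _ := by ring

/-! ### Approach regions and tangential dilations -/

theorem tendsto_re_normalCoord : Tendsto (fun z => (normalCoord ξ ν z).re) (𝓝 ξ) (𝓝 0) := by
  have : Continuous fun z => (normalCoord ξ ν z).re := by unfold normalCoord; fun_prop
  simpa [normalCoord] using this.tendsto ξ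

theorem eventually_norm_sub_lt {r : ℝ} (hr : 0 < r) : ∀ᶠ z : Cn n in 𝓝 ξ, ‖z - ξ‖ < r := by
  filter_upwards [Metric.ball_mem_nhds ξ hr] with z hz
  rwa [← dist_eq_norm]

/-- A sufficient condition for lying in an approach region, free of the defining function. -/
theorem IsC2GraphAt.exists_mem_approachRegion (hψ : IsC2GraphAt D ξ ν ψ) {β : ℝ} (hβ : 0 < β) :
    ∃ η > 0, ∀ᶠ p in 𝓝 ξ, 0 < (normalCoord ξ ν p).re →
      ‖p - ξ‖ ^ 2 ≤ η * (normalCoord ξ ν p).re →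
      |(normalCoord ξ ν p).im| < β * (normalCoord ξ ν p).re → p ∈ approachRegion D ξ ν ψ β := by
  obtain ⟨C, hC, r, hr, h⟩ := exists_abs_sub_le hψ.contDiffAt hψ.fderiv_zero
  -- The first bound gives `|ψ| ≤ x₁/2`, hence `d ≥ x₁/2`; the second then gives `|p - ξ|² ≤ βx₁/4 <
  -- βd`.
  refine ⟨min (1 / (2 * C)) (β / 4), by positivity, ?_⟩
  filter_upwards [hψ.mem_iff, eventually_norm_sub_lt hr] with p hp hpr h0 h1 h2
  have ht := norm_tangentialPart_le (ξ := ξ) hψ.norm_normal p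
  have h3 : |ψ (tangentialPart ξ ν p)| ≤ C * ‖p - ξ‖ ^ 2 := by
    have := h ‖p - ξ‖ hpr (tangentialPart ξ ν p) 0 ht (by simp)
    rw [hψ.map_zero, sub_zero, sub_zero] at this
    refine this.trans ?_
    rw [pow_two, ← mul_assoc]; gcongr
  set x := (normalCoord ξ ν p).re with hx
  have h4 : C * ‖p - ξ‖ ^ 2 ≤ x / 2 := by
    have : ‖p - ξ‖ ^ 2 ≤ 1 / (2 * C) * x := h1.trans (by gcongr; exact min_le_left _ _)
    calc C * ‖p - ξ‖ ^ 2 ≤ C * (1 / (2 * C) * x) := by gcongr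
      _ = x / 2 := by field_simp
  have h5 := (abs_le.1 h3).2
  have h6 : x / 2 ≤ graphDist ξ ν ψ p := by
    rw [graphDist, ← hx]; exact le_min (by linarith) (by linarith)
  refine ⟨hp.2 (by linarith), ?_, h2⟩
  have h7 : ‖p - ξ‖ ^ 2 ≤ β / 4 * x := h1.trans (by gcongr; exact min_le_right _ _)
  nlinarith

/-- The point `ξ - x₁ ν + c ζ`, where `z = ξ - x₁ ν + ζ` with `ζ` in the tangent hyperplane. -/
def tangentialDilation (ξ ν z : Cn n) (c : ℂ) : Cn n :=
  ξ - (normalCoord ξ ν z).re • ν + c • tangentialPart ξ ν z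

theorem tangentialDilation_one (z : Cn n) : tangentialDilation ξ ν z 1 = z := by
  rw [tangentialDilation, tangentialPart]; module

/-- The tangential part is only real-orthogonal to `ν`: it retains the component `iy₁(-ν)`, which is
multiplied by `c`. Nonreal `c` therefore changes `x₁` as well. -/
theorem normalCoord_tangentialDilation (hν : ‖ν‖ = 1) (z : Cn n) (c : ℂ) :
    normalCoord ξ ν (tangentialDilation ξ ν z c) =
      (normalCoord ξ ν z).re + c * ((normalCoord ξ ν z).im * Complex.I) := by
  have e : tangentialDilation ξ ν z c - ξ =
      c • tangentialPart ξ ν z - (normalCoord ξ ν z).re • ν := by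
    rw [tangentialDilation]; module
  rw [normalCoord, e, inner_neg_left, inner_sub_right, inner_smul_right, inner_tangentialPart hν,
    inner_real_smul_right', inner_self_of_unit hν]
  ring

theorem re_normalCoord_tangentialDilation (hν : ‖ν‖ = 1) (z : Cn n) (c : ℂ) :
    (normalCoord ξ ν (tangentialDilation ξ ν z c)).re =
      (normalCoord ξ ν z).re - c.im * (normalCoord ξ ν z).im := by
  rw [normalCoord_tangentialDilation hν]; simp; ring

theorem im_normalCoord_tangentialDilation (hν : ‖ν‖ = 1) (z : Cn n) (c : ℂ) :
    (normalCoord ξ ν (tangentialDilation ξ ν z c)).im = c.re * (normalCoord ξ ν z).im := by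
  rw [normalCoord_tangentialDilation hν]; simp

theorem tangentialPart_tangentialDilation (hν : ‖ν‖ = 1) (z : Cn n) (c : ℂ) :
    tangentialPart ξ ν (tangentialDilation ξ ν z c) =
      c • tangentialPart ξ ν z - (c.im * (normalCoord ξ ν z).im) • ν := by
  conv_lhs => rw [tangentialPart, re_normalCoord_tangentialDilation hν]
  rw [tangentialDilation]; module

theorem norm_tangentialDilation_sub_le (hν : ‖ν‖ = 1) (z : Cn n) (c : ℂ) :
    ‖tangentialDilation ξ ν z c - ξ‖ ≤
      |(normalCoord ξ ν z).re| + ‖c‖ * ‖tangentialPart ξ ν z‖ := by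
  have e : tangentialDilation ξ ν z c - ξ =
      c • tangentialPart ξ ν z - (normalCoord ξ ν z).re • ν := by
    rw [tangentialDilation]; module
  rw [e]
  refine (norm_sub_le _ _).trans ?_
  rw [norm_smul, norm_smul, hν, mul_one, Real.norm_eq_abs]
  linarith

theorem eventually_norm_tangentialDilation_sub_lt (hν : ‖ν‖ = 1) {r : ℝ} (hr : 0 < r) {B : ℝ}
    (hB : 0 ≤ B) :
    ∀ᶠ z in 𝓝 ξ, ∀ c : ℂ, ‖c‖ ≤ B → ‖tangentialDilation ξ ν z c - ξ‖ < r := by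
  filter_upwards [eventually_norm_sub_lt (ξ := ξ) (r := r / (1 + B)) (by positivity)] with z hz c hc
  refine (norm_tangentialDilation_sub_le hν z c).trans_lt ?_
  rw [lt_div_iff₀ (by positivity)] at hz
  have h1 := abs_re_normalCoord_le (ξ := ξ) hν z
  have h2 := norm_tangentialPart_le (ξ := ξ) hν z
  nlinarith [norm_nonneg c, norm_nonneg (tangentialPart ξ ν z)]

/-- Strong tangential contractions map an approach region into any other one, near the vertex. -/
theorem IsC2GraphAt.exists_tangentialDilation_mem_of_small (hψ : IsC2GraphAt D ξ ν ψ) {α β : ℝ}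
    (hα : 0 < α) (hβ : 0 < β) :
    ∃ ε > 0, ε ≤ 1 ∧ ∀ᶠ z in 𝓝[approachRegion D ξ ν ψ α] ξ, ∀ c ∈ Metric.ball (0 : ℂ) ε,
      tangentialDilation ξ ν z c ∈ approachRegion D ξ ν ψ β := by
  have hν := hψ.norm_normal
  obtain ⟨η, hη, h⟩ := hψ.exists_mem_approachRegion hβ
  obtain ⟨r, hr, h⟩ := Metric.eventually_nhds_iff.1 h
  -- With `εα ≤ k`, the terms `Re c · y₁` and `Im c · y₁` are at most `kx₁`. The three bounds on `k`
  -- respectively keep half of `x₁`, make `|p - ξ|²` small against `ηx₁`, and make the new `|y₁|`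
  -- small against `βx₁`.
  set k := min (1 / 2) (min (η / 8) (β / 4)) with hk
  have hk0 : 0 < k := by positivity
  have hk1 : k ≤ 1 / 2 := min_le_left _ _
  have hk2 : k ≤ η / 8 := (min_le_right _ _).trans (min_le_left _ _)
  have hk3 : k ≤ β / 4 := (min_le_right _ _).trans (min_le_right _ _)
  set ε := min 1 (k / α) with hε
  have hε0 : 0 < ε := by positivity
  have hε1 : ε ≤ 1 := min_le_left _ _
  have hεα : ε * α ≤ k := (le_div_iff₀ hα).1 (min_le_right _ _)
  refine ⟨ε, hε0, hε1, ?_⟩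
  filter_upwards [self_mem_nhdsWithin,
    nhdsWithin_le_nhds (eventually_norm_tangentialDilation_sub_lt hν hr zero_le_one),
    nhdsWithin_le_nhds (tendsto_re_normalCoord.eventually_lt_const
      (show (0 : ℝ) < η / 8 by positivity))] with z hz hzr hzx c hc
  rw [mem_ball_zero_iff] at hc
  have hd := graphDist_pos_of_mem hα hz
  have hdx : graphDist ξ ν ψ z ≤ (normalCoord ξ ν z).re := min_le_left _ _
  have hsq := hz.2.1
  have hy := hz.2.2
  have ht := norm_tangentialPart_le (ξ := ξ) hν z
  have hp := norm_tangentialDilation_sub_le (ξ := ξ) hν z c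
  have him := im_normalCoord_tangentialDilation (ξ := ξ) hν z c
  have hre := re_normalCoord_tangentialDilation (ξ := ξ) hν z c
  set x := (normalCoord ξ ν z).re
  set y := (normalCoord ξ ν z).im
  have hx : 0 < x := hd.trans_le hdx
  have hcy : ∀ t : ℝ, |t| ≤ ‖c‖ → |t * y| ≤ k * x := fun t ht => by
    rw [abs_mul]
    calc |t| * |y| ≤ ε * (α * x) := by gcongr; exact ht.trans hc.le
      _ = ε * α * x := by ring
      _ ≤ k * x := by gcongr
  have h1 := abs_le.1 (hcy c.im (Complex.abs_im_le_norm c))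
  have h2 : x / 2 ≤ (normalCoord ξ ν (tangentialDilation ξ ν z c)).re := by
    rw [hre]; nlinarith [h1.2]
  refine h (by rw [dist_eq_norm]; exact hzr c (hc.le.trans hε1)) (by linarith) ?_ ?_
  · have h3 : ‖tangentialPart ξ ν z‖ ^ 2 ≤ α * x := by
      have : ‖tangentialPart ξ ν z‖ ^ 2 ≤ ‖z - ξ‖ ^ 2 := by gcongr
      nlinarith
    rw [abs_of_pos hx] at hp
    have h4 : ‖tangentialDilation ξ ν z c - ξ‖ ^ 2 ≤ (x + ε * ‖tangentialPart ξ ν z‖) ^ 2 := by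
      gcongr; exact hp.trans (by gcongr)
    have h5 : ε ^ 2 * ‖tangentialPart ξ ν z‖ ^ 2 ≤ η / 8 * x := by
      calc ε ^ 2 * ‖tangentialPart ξ ν z‖ ^ 2 ≤ ε ^ 2 * (α * x) := by gcongr
        _ = ε * (ε * α * x) := by ring
        _ ≤ 1 * (η / 8 * x) := by gcongr; exact hεα.trans hk2
        _ = _ := one_mul _
    have h6 : x ^ 2 ≤ η / 8 * x := by rw [pow_two]; gcongr
    have h7 : (x + ε * ‖tangentialPart ξ ν z‖) ^ 2 ≤
        2 * x ^ 2 + 2 * (ε ^ 2 * ‖tangentialPart ξ ν z‖ ^ 2) := by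
      nlinarith [sq_nonneg (x - ε * ‖tangentialPart ξ ν z‖)]
    nlinarith
  · rw [him]
    have := hcy c.re (Complex.abs_re_le_norm c)
    nlinarith

/-- Tangential dilations with factor near `[0, 1]` map an approach region into a wider one, without
coming much closer to the boundary. -/
theorem IsC2GraphAt.exists_tangentialDilation_mem (hψ : IsC2GraphAt D ξ ν ψ) {α : ℝ}
    (hα : 0 < α) :
    ∃ α' > 0, ∃ N > 0, ∃ R > 0, R ≤ 1 ∧ ∀ᶠ z in 𝓝[approachRegion D ξ ν ψ α] ξ,
      ∀ s ∈ Set.Icc (0 : ℝ) 1, ∀ c ∈ Metric.ball (s : ℂ) R,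
        tangentialDilation ξ ν z c ∈ approachRegion D ξ ν ψ α' ∧
        |(normalCoord ξ ν z).im| ≤ N * graphDist ξ ν ψ (tangentialDilation ξ ν z c) ∧
        ‖tangentialPart ξ ν z‖ ^ 2 ≤ N * graphDist ξ ν ψ (tangentialDilation ξ ν z c) := by
  have hν := hψ.norm_normal
  obtain ⟨C, hC, r, hr, hL⟩ := exists_abs_sub_le hψ.contDiffAt hψ.fderiv_zero
  set δ := 1 / (8 * α) with hδ
  have hδ0 : 0 < δ := by positivity
  have hδα : δ * α = 1 / 8 := by rw [hδ]; field_simp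
  obtain ⟨r', hr', hH⟩ := exists_abs_smul_sub_le hψ.contDiffAt hψ.map_zero hψ.fderiv_zero hδ0
  obtain ⟨r'', hr'', hD⟩ := Metric.eventually_nhds_iff.1 hψ.mem_iff
  set B := α * (1 + C * α) with hB
  have hB0 : 0 < B := by positivity
  -- The last three bounds respectively limit the change of `x₁` off the real axis to `d/8` and to
  -- `x₁/2`, and the resulting change of `ψ` to `d/8`. With the `d/8` from the choice of `δ`, at
  -- least `d/2` survives.
  set R := min 1 (min (1 / (8 * B)) (min (1 / (2 * α)) (1 / (48 * C * α)))) with hR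
  have hR0 : 0 < R := by positivity
  have hR1 : R ≤ 1 := min_le_left _ _
  have hRB : R * B ≤ 1 / 8 := by
    have : R ≤ 1 / (8 * B) := (min_le_right _ _).trans (min_le_left _ _)
    calc R * B ≤ 1 / (8 * B) * B := by gcongr
      _ = 1 / 8 := by field_simp
  have hRα : R * α ≤ 1 / 2 := by
    have : R ≤ 1 / (2 * α) :=
      (min_le_right _ _).trans ((min_le_right _ _).trans (min_le_left _ _))
    calc R * α ≤ 1 / (2 * α) * α := by gcongr
      _ = 1 / 2 := by field_simp
  have hRC : R * (C * α) ≤ 1 / 48 := by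
    have : R ≤ 1 / (48 * C * α) :=
      (min_le_right _ _).trans ((min_le_right _ _).trans (min_le_right _ _))
    calc R * (C * α) ≤ 1 / (48 * C * α) * (C * α) := by gcongr
      _ = 1 / 48 := by field_simp
  clear_value R B δ
  -- `18 = 9 · 2`: dilation at most triples the distance to `ξ` and at most halves `d`. The two
  -- terms of `2B + 2α` come from `|y₁| ≤ Bd` and `|ζ|² ≤ αd`.
  refine ⟨18 * α, by positivity, 2 * B + 2 * α, by positivity, R, hR0, hR1, ?_⟩
  filter_upwards [self_mem_nhdsWithin,
    nhdsWithin_le_nhds (eventually_norm_tangentialDilation_sub_lt hν hr'' zero_le_two),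
    nhdsWithin_le_nhds (eventually_norm_sub_lt (ξ := ξ) (r := r / 3) (by positivity)),
    nhdsWithin_le_nhds (eventually_norm_sub_lt (ξ := ξ) hr')] with z hz hzr hzr2 hzr3 s hs c hc
  rw [mem_ball_iff_norm] at hc
  have hcn : ‖c‖ ≤ 2 := by
    have h1 := norm_add_le (c - s) (s : ℂ)
    rw [sub_add_cancel, Complex.norm_real, Real.norm_of_nonneg hs.1] at h1
    linarith [hs.2]
  have hci : |c.im| ≤ R := by
    have := Complex.abs_im_le_norm (c - s)
    rw [Complex.sub_im, Complex.ofReal_im, sub_zero] at this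
    exact this.trans hc.le
  have hmem := hD (y := tangentialDilation ξ ν z c)
    (by rw [dist_eq_norm]; exact hzr c hcn)
  have hd := graphDist_pos_of_mem hα hz
  have hdx : graphDist ξ ν ψ z ≤ (normalCoord ξ ν z).re := min_le_left _ _
  have hdψ : graphDist ξ ν ψ z ≤ (normalCoord ξ ν z).re - ψ (tangentialPart ξ ν z) :=
    min_le_right _ _
  have hdmin : graphDist ξ ν ψ z = min (normalCoord ξ ν z).re
    ((normalCoord ξ ν z).re - ψ (tangentialPart ξ ν z)) := rfl
  have hsq := hz.2.1
  have hy := hz.2.2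
  have ht := norm_tangentialPart_le (ξ := ξ) hν z
  have hyt := abs_im_normalCoord_le (ξ := ξ) hν z
  have hp := norm_tangentialDilation_sub_le (ξ := ξ) hν z c
  have hxz := abs_re_normalCoord_le (ξ := ξ) hν z
  have him := im_normalCoord_tangentialDilation (ξ := ξ) hν z c
  have hre := re_normalCoord_tangentialDilation (ξ := ξ) hν z c
  have htp := tangentialPart_tangentialDilation (ξ := ξ) hν z c
  have hgp : graphDist ξ ν ψ (tangentialDilation ξ ν z c) =
    min (normalCoord ξ ν (tangentialDilation ξ ν z c)).re
      ((normalCoord ξ ν (tangentialDilation ξ ν z c)).re -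
        ψ (tangentialPart ξ ν (tangentialDilation ξ ν z c))) := rfl
  set d := graphDist ξ ν ψ z
  set x := (normalCoord ξ ν z).re
  set y := (normalCoord ξ ν z).im
  set u := tangentialPart ξ ν z
  set p := tangentialDilation ξ ν z c
  have hx : 0 < x := hd.trans_le hdx
  have hu2 : ‖u‖ ^ 2 ≤ α * d := (pow_le_pow_left₀ (norm_nonneg _) ht 2).trans hsq.le
  -- comparison of `x₁` with `d`
  have hxd : x ≤ (1 + C * α) * d := by
    have h1 := hL ‖u‖ (by linarith) u 0 le_rfl (by simp)
    rw [hψ.map_zero, sub_zero, sub_zero] at h1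
    have h2 := (abs_le.1 h1).2
    have h3 : C * ‖u‖ * ‖u‖ ≤ C * α * d := by
      rw [mul_assoc, ← pow_two, mul_assoc]; gcongr
    rcases min_choice x (x - ψ u) with h | h <;> rw [h] at hdmin
    · linarith [mul_pos (mul_pos hC hα) hd]
    · linarith
  have hyB : |y| ≤ B * d := by
    calc |y| ≤ α * x := hy.le
      _ ≤ α * ((1 + C * α) * d) := by gcongr
      _ = B * d := by rw [hB]; ring
  -- the tangential part of the dilated point
  have hdist : ‖tangentialPart ξ ν p - s • u‖ ≤ 2 * R * ‖u‖ := by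
    have e : tangentialPart ξ ν p - s • u = (c - s) • u - (c.im * y) • ν := by
      rw [htp, sub_smul, Complex.coe_smul]; abel
    rw [e]
    refine (norm_sub_le _ _).trans ?_
    rw [norm_smul, norm_smul, hν, mul_one, Real.norm_eq_abs, abs_mul]
    have h1 : ‖c - s‖ * ‖u‖ ≤ R * ‖u‖ := by gcongr
    have h2 : |c.im| * |y| ≤ R * ‖u‖ := by gcongr
    linarith
  have hsu : ‖s • u‖ ≤ ‖u‖ := by
    rw [norm_smul, Real.norm_of_nonneg hs.1]
    exact mul_le_of_le_one_left (norm_nonneg _) hs.2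
  have hpu : ‖tangentialPart ξ ν p‖ ≤ 3 * ‖u‖ := by
    have h1 := norm_add_le (tangentialPart ξ ν p - s • u) (s • u)
    rw [sub_add_cancel] at h1
    have h2 : 2 * R * ‖u‖ ≤ 2 * 1 * ‖u‖ := by gcongr
    linarith
  have hψp : ψ (tangentialPart ξ ν p) ≤ s ^ 2 * ψ u + d / 4 := by
    have h1 := (abs_le.1 (hL (3 * ‖u‖) (by linarith) _ (s • u) hpu
      (by linarith [norm_nonneg u]))).2
    have h2 := (abs_le.1 (hH u (by linarith) s hs)).2
    have h3 : C * (3 * ‖u‖) * ‖tangentialPart ξ ν p - s • u‖ ≤ d / 8 := by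
      calc C * (3 * ‖u‖) * ‖tangentialPart ξ ν p - s • u‖
          ≤ C * (3 * ‖u‖) * (2 * R * ‖u‖) := by gcongr
        _ = 6 * (R * C) * ‖u‖ ^ 2 := by ring
        _ ≤ 6 * (R * C) * (α * d) := by gcongr
        _ = 6 * (R * (C * α)) * d := by ring
        _ ≤ 6 * (1 / 48) * d := by gcongr
        _ = d / 8 := by ring
    have h4 : δ * ‖u‖ ^ 2 ≤ d / 8 := by
      calc δ * ‖u‖ ^ 2 ≤ δ * (α * d) := by gcongr
        _ = δ * α * d := by ring
        _ = d / 8 := by rw [hδα]; ring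
    linarith
  have hcy : |c.im * y| ≤ R * |y| := by rw [abs_mul]; gcongr
  have hcy1 : |c.im * y| ≤ d / 8 := by
    calc |c.im * y| ≤ R * (B * d) := hcy.trans (by gcongr)
      _ = R * B * d := by ring
      _ ≤ 1 / 8 * d := by gcongr
      _ = d / 8 := by ring
  have hcy2 : |c.im * y| ≤ x / 2 := by
    calc |c.im * y| ≤ R * (α * x) := hcy.trans (by gcongr)
      _ = R * α * x := by ring
      _ ≤ 1 / 2 * x := by gcongr
      _ = x / 2 := by ring
  -- The right side is a convex combination of `x` and `x - ψ u`, both at least `d`.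
  have hs2 : d ≤ x - s ^ 2 * ψ u := by
    have : s ^ 2 ≤ 1 := pow_le_one₀ hs.1 hs.2
    rcases le_total 0 (ψ u) with h | h
    · linarith [mul_le_of_le_one_left h this]
    · linarith [mul_nonpos_of_nonneg_of_nonpos (sq_nonneg s) h]
  have hxp : x / 2 ≤ (normalCoord ξ ν p).re := by
    rw [hre]; linarith [(abs_le.1 hcy2).2]
  have hψp' : d / 2 ≤ (normalCoord ξ ν p).re - ψ (tangentialPart ξ ν p) := by
    rw [hre]; linarith [(abs_le.1 hcy1).2]
  have hgd : d / 2 ≤ graphDist ξ ν ψ p := by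
    rw [hgp]; exact le_min (by linarith) hψp'
  refine ⟨⟨hmem.2 (by linarith), ?_, ?_⟩, ?_, ?_⟩
  · have h1 : ‖p - ξ‖ ≤ 3 * ‖z - ξ‖ := by
      have : ‖c‖ * ‖u‖ ≤ 2 * ‖z - ξ‖ := by gcongr
      linarith
    have h2 : ‖p - ξ‖ ^ 2 ≤ (3 * ‖z - ξ‖) ^ 2 := by gcongr
    have h3 : α * d ≤ α * (2 * graphDist ξ ν ψ p) := by gcongr; linarith
    rw [mul_pow] at h2
    linarith
  · rw [him, abs_mul]
    have h1 : |c.re| ≤ 2 := (Complex.abs_re_le_norm c).trans hcn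
    have h2 : |c.re| * |y| ≤ 2 * (α * x) := by gcongr
    have h3 : 0 < α * x := mul_pos hα hx
    have h4 : α * (x / 2) ≤ α * (normalCoord ξ ν p).re := by gcongr
    linarith
  · have h1 : B * d ≤ B * (2 * graphDist ξ ν ψ p) := by gcongr; linarith
    have h2 : 0 ≤ α * graphDist ξ ν ψ p := mul_nonneg hα.le (by linarith)
    linarith
  · have h1 : α * d ≤ α * (2 * graphDist ξ ν ψ p) := by gcongr; linarith
    have h2 : 0 ≤ B * graphDist ξ ν ψ p := mul_nonneg hB0.le (by linarith)
    linarith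

/-! ### Comparison with admissible domains -/

/-- Near the vertex, the admissible domains are contained in the approach regions. -/
theorem IsC2GraphAt.tendsto_admissibleDomain (hψ : IsC2GraphAt D ξ ν ψ) {α : ℝ} (hα : 0 < α) :
    𝓝[admissibleDomain D ξ ν α] ξ ≤ 𝓝[approachRegion D ξ ν ψ (1 + α)] ξ := by
  have hν := hψ.norm_normal
  refine le_inf (nhdsWithin_le_nhds) (le_principal_iff.2 ?_)
  have hc : Tendsto (fun z : Cn n => z + ((normalCoord ξ ν z).re - ψ (tangentialPart ξ ν z)) • ν)
      (𝓝 ξ) (𝓝 ξ) := by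
    have h1 : ContinuousAt (tangentialPart ξ ν) ξ := by
      unfold tangentialPart normalCoord; fun_prop
    have h2 : ContinuousAt (fun z => ψ (tangentialPart ξ ν z)) ξ := by
      refine ContinuousAt.comp' ?_ h1
      rw [tangentialPart_self]; exact hψ.contDiffAt.continuousAt
    have h3 : Tendsto (fun z => ψ (tangentialPart ξ ν z)) (𝓝 ξ) (𝓝 0) := by
      have := h2.tendsto
      rwa [tangentialPart_self, hψ.map_zero] at this
    simpa using tendsto_id.add ((tendsto_re_normalCoord.sub h3).smul_const ν)
  filter_upwards [self_mem_nhdsWithin, nhdsWithin_le_nhds hψ.mem_iff,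
    nhdsWithin_le_nhds (hc.eventually hψ.mem_iff)] with z hz hzD hq
  obtain ⟨hzm, hx, hn, hsq⟩ := hz
  have hpos : 0 < (normalCoord ξ ν z).re - ψ (tangentialPart ξ ν z) := sub_pos.2 (hzD.1 hzm)
  have h1 : stdDist D ξ ν z ≤ (normalCoord ξ ν z).re := by
    refine (min_le_right _ _).trans ?_
    have hm : z + (normalCoord ξ ν z).re • ν ∈ tangentPlane ξ ν := by
      have := re_normalCoord_add_smul (ξ := ξ) (ν := ν) z ν (normalCoord ξ ν z).re
      rw [inner_self_of_unit hν, Complex.one_re, mul_one, sub_self, re_normalCoord] at this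
      exact neg_eq_zero.1 this
    refine (Metric.infDist_le_dist_of_mem hm).trans ?_
    rw [dist_self_add_right, norm_smul, hν, mul_one, Real.norm_of_nonneg hx.le]
  have h2 : stdDist D ξ ν z ≤ (normalCoord ξ ν z).re - ψ (tangentialPart ξ ν z) := by
    refine (min_le_left _ _).trans ?_
    -- The projection of `z` along `ν` onto the graph of `ψ`. It lies outside `D`, so the distance
    -- from `z` to the complement, attained on `∂D`, is at most `x₁ - ψ`.
    set q := z + ((normalCoord ξ ν z).re - ψ (tangentialPart ξ ν z)) • ν with hq_def
    have hqD : q ∉ D := by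
      rw [hq, hq_def, tangentialPart_add_smul, re_normalCoord_add_smul, inner_self_of_unit hν]
      simp
    obtain ⟨y, hy, hyd⟩ := exists_mem_frontier_infDist_compl_eq_dist hzm
      (fun h => hqD (h ▸ Set.mem_univ q))
    calc Metric.infDist z (frontier D) ≤ dist z y := Metric.infDist_le_dist_of_mem hy
      _ = Metric.infDist z Dᶜ := hyd.symm
      _ ≤ dist z q := Metric.infDist_le_dist_of_mem hqD
      _ = _ := by
        rw [hq_def, dist_self_add_right, norm_smul, hν, mul_one, Real.norm_of_nonneg hpos.le]
  have h3 : stdDist D ξ ν z ≤ graphDist ξ ν ψ z := le_min h1 h2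
  have h4 : 0 < stdDist D ξ ν z := pos_of_mul_pos_right ((sq_nonneg _).trans_lt hsq) hα.le
  refine ⟨hzm, by nlinarith, ?_⟩
  have h5 : |(normalCoord ξ ν z).im| ≤ ‖inner ℂ ν (z - ξ)‖ := by
    rw [← norm_neg, ← inner_neg_left]; exact Complex.abs_im_le_norm _
  nlinarith

end AdmissibleLimit

end

/-! ### Existence of the admissible limit -/

open Filter Topology AdmissibleLimit in
theorem theorem5 {n : ℕ} (hn : 1 < n) (D : Set (Cn n)) (hDo : IsOpen D) (hDc : IsConnected D)
    (hD : HasC2Boundary D) (ξ : Cn n) (hξ : ξ ∈ frontier D)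
    (ν : Cn n) (ψ : Cn n → ℝ) (hψ : IsC2GraphAt D ξ ν ψ)
    (f : Cn n → ℂ)
    (hf : ∀ α : ℝ, 0 < α →
      ∀ᶠ z in 𝓝[approachRegion D ξ ν ψ α] ξ, DifferentiableAt ℂ f z)
    (hK : ∀ α : ℝ, 0 < α → ∃ K : ℝ,
      ∀ᶠ z in 𝓝[approachRegion D ξ ν ψ α] ξ,
        SphericalDerivBounds D f z (K / graphDist ξ ν ψ z) (K / √(graphDist ξ ν ψ z)))
    (L : OnePoint ℂ) (β : ℝ) (hβ : 0 < β)
    (hL : HasLimitWithin f (approachRegion D ξ ν ψ β) ξ L) :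
    (∀ α : ℝ, 0 < α → HasLimitWithin f (approachRegion D ξ ν ψ α) ξ L) ∧
    (∀ α : ℝ, 0 < α → HasLimitWithin f (admissibleDomain D ξ ν α) ξ L) := by
  have hν := hψ.norm_normal
  have main : ∀ α : ℝ, 0 < α → HasLimitWithin f (approachRegion D ξ ν ψ α) ξ L := by
    intro α hα
    obtain ⟨ε, hε, hε1, hsmall⟩ := hψ.exists_tangentialDilation_mem_of_small hα hβ
    obtain ⟨α', hα', N, hN, R, hR, hR1, hpath⟩ := hψ.exists_tangentialDilation_mem hα
    obtain ⟨K, hK'⟩ := hK α' hα'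
    obtain ⟨M, hM, hder⟩ :=
      exists_norm_fderiv_le_of_sphericalDerivBounds hDo hD hξ hψ hα' hK'
    -- the regularity of `f` near the images of the dilations
    have hreg := (hf α' hα').and hder
    rw [eventually_nhdsWithin_iff, Metric.eventually_nhds_iff] at hreg
    obtain ⟨r, hr, hreg⟩ := hreg
    have hclose := (eventually_norm_tangentialDilation_sub_lt (ξ := ξ) hν hr zero_le_two)
    have hcn : ∀ s ∈ Set.Icc (0 : ℝ) 1, ∀ c ∈ Metric.ball (s : ℂ) R, ‖c‖ ≤ 2 := by
      intro s hs c hc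
      rw [mem_ball_iff_norm] at hc
      have h1 := norm_add_le (c - s) (s : ℂ)
      rw [sub_add_cancel, Complex.norm_real, Real.norm_of_nonneg hs.1] at h1
      linarith [hs.2]
    have hderiv : ∀ z c, DifferentiableAt ℂ f (tangentialDilation ξ ν z c) →
        HasDerivAt (fun c => f (tangentialDilation ξ ν z c))
          (fderiv ℂ f (tangentialDilation ξ ν z c) (tangentialPart ξ ν z)) c := by
      intro z c h
      refine h.hasFDerivAt.comp_hasDerivAt c ?_
      have := ((hasDerivAt_id c).smul_const (tangentialPart ξ ν z)).const_add
        (ξ - (normalCoord ξ ν z).re • ν)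
      exact this.congr_deriv (one_smul _ _)
    have key : Tendsto (fun z => (f (tangentialDilation ξ ν z 1) : OnePoint ℂ))
        (𝓝[approachRegion D ξ ν ψ α] ξ) (𝓝 L) := by
      -- The family is indexed by `z → ξ` in `A_α`. In `M(N + √N)` the terms come from the normal
      -- component `|y₁| ≤ Nd` over `d` and the length `|ζ| ≤ √(Nd)` over `√d`, with `d` taken at
      -- the dilated point.
      refine tendsto_one_of_tendsto_ball_zero
        (g := fun z c => f (tangentialDilation ξ ν z c)) (M := M * (N + √N)) hR hε ?_ ?_ ?_
      · filter_upwards [hpath, nhdsWithin_le_nhds hclose] with z h1 h2 s hs c hc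
        exact (hderiv z c (hreg (by rw [dist_eq_norm]; exact h2 c (hcn s hs c hc))
          (h1 s hs c hc).1).1).differentiableAt
      · filter_upwards [hpath, nhdsWithin_le_nhds hclose] with z h1 h2 s hs c hc
        obtain ⟨h3, h4, h5⟩ := h1 s hs c hc
        obtain ⟨h6, h7⟩ := hreg (by rw [dist_eq_norm]; exact h2 c (hcn s hs c hc)) h3
        have hd := graphDist_pos_of_mem hα' h3
        rw [(hderiv z c h6).deriv]
        refine (h7 (tangentialPart ξ ν z)).trans ?_
        gcongr
        · rw [div_le_iff₀ hd, inner_tangentialPart hν]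
          simpa using h4
        · rw [div_le_iff₀ (Real.sqrt_pos.2 hd), ← Real.sqrt_mul hN.le]
          exact Real.le_sqrt_of_sq_le h5
      -- For `|c| < ε` the dilated points tend to `ξ` inside `A_β` uniformly in `c`, so the
      -- hypothesis yields the initial uniform limit.
      · refine hL.comp (f := fun p : Cn n × ℂ => tangentialDilation ξ ν p.1 p.2)
          (tendsto_nhdsWithin_iff.2 ⟨?_, ?_⟩)
        · rw [Metric.tendsto_nhds]
          intro e he
          rw [eventually_prod_principal_iff]
          filter_upwards [nhdsWithin_le_nhds
            (eventually_norm_tangentialDilation_sub_lt (ξ := ξ) hν he zero_le_one)] with z hz c hc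
          rw [mem_ball_zero_iff] at hc
          rw [dist_eq_norm]
          exact hz c (hc.le.trans hε1)
        · rw [eventually_prod_principal_iff]
          exact hsmall
    simpa only [tangentialDilation_one, HasLimitWithin] using key
  exact ⟨main, fun α hα => (main (1 + α) (by positivity)).mono_left
    (hψ.tendsto_admissibleDomain hα)⟩
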